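/- Let $\mathbb N=\{1,2,\dots\}$. Let $a=(a_j)_{j\in\mathbb N}$ be a non-decreasing sequence of positive numbers with $a_j\to\infty$, let $b=(b_j)_{j\in\mathbb N}$ be a sequence of positive numbers, let $0<C_0\le 1\le C_1<\infty$ and $\alpha,\beta\in(0,1)$. Put $$\mathcal E_a=\Big\{\theta\in l^2(\mathbb N):\sum_j a_j^2\theta_j^2\le 1\Big\},\quad \Theta_a(r)=\{\theta\in\mathcal E_a:\|\theta\|\ge r\},\quad \mathcal B(b)=\{\nu\in\mathbb R^{\mathbb N}: C_0|b_j|\le|\nu_j|\le C_1|b_j|\ \text{for all } j\}.$$ For $\varepsilon,\sigma\ge 0$, $\theta\in l^2(\mathbb N)$ and $\bar b\in\mathbb R^{\mathbb N}$ let $\mathbb P^{\varepsilon,\sigma}_{\theta,\bar b}$ be the law of $(Y,X)=(Y_j,X_j)_{j\in\mathbb N}$, where $$Y_j=\bar b_j\theta_j+\varepsilon\,\xi_j,\qquad X_j=\bar b_j+\sigma\,\eta_j,$$ with $\xi,\eta$ independent sequences of independent standard Gaussian variables. The null hypothesis is $\theta=\theta_0$, where the benchmark $\theta_0\in\mathcal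 E_a\setminus\{0\}$ is known to the statistician. Thus a testing procedure $\Psi$ consists of a measurable function $\Psi_{\theta_0}(Y,X)$ for each $\theta_0$, giving the probability of rejecting the null hypothesis; it is non-randomized if its values lie in $\{0,1\}$ and randomized if they lie in $[0,1]$. For a set $T\subseteq\mathcal E_a\setminus\{0\}$ of benchmarks and a set $B$ of sequences, $\Psi$ is an $\alpha$-level test if $\mathbb E^{\varepsilon,\sigma}_{\theta_0,\bar b}\Psi_{\theta_0}\le\alpha$ for all $\theta_0\in T$ and $\bar b\in B$. Its separation radius is the infimum of the $r>0$ such that $\mathbb E^{\varepsilon,\sigma}_{\theta,\bar b}(1-\Psi_{\theta_0})\le\beta$ for all $\theta_0\in T$, all $\theta$ with $\theta-\theta_0\in\Theta_a(r)$ and all $\bar b\in B$. The minimax separation radius is the infimum of the separation radii over all $\alpha$-level tests. For $\varepsilon,\sigma>0$ let - $\tilde r_{\varepsilon,\sigma}(T)$ be the minimax separation radius with noise levels $\varepsilon,\sigma$ and $B=\mathcal B(b)$, over either the randomized or the non-randomized tests; - $\tilde r_{0,\sigma}(T)$ be the one with noise levels $0,\sigma$ and $B=\mathcal B(b)$, over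 the randomized tests; - $\tilde r_{\varepsilon,0}(T)$ be the one with noise levels $\varepsilon,0$ and $B=\{b\}$ (that is, $b$ is known), over the randomized tests. Write $\tilde r_{\varepsilon,\sigma}$ for $\tilde r_{\varepsilon,\sigma}(\mathcal E_a\setminus\{0\})$. **Theorem 4.** Let $\varepsilon>0$ and $\sigma>0$. (1) For every $T\subseteq\mathcal E_a\setminus\{0\}$ (in particular for one given benchmark, $T=\{\theta_0\}$, and for all of them together, $T=\mathcal E_a\setminus\{0\}$), $$\tilde r_{\varepsilon,\sigma}(T)\ \ge\ \tilde r_{0,\sigma}(T)\vee\tilde r_{\varepsilon,0}(T).$$ (2) Suppose that $\alpha+\beta<1$. Put $$C_{\alpha,\beta}=\ln(1+4(1-\alpha-\beta)^2),\qquad c_{\alpha,\beta}=\big(2\ln(1+4(1-\alpha-\beta)^2)\big)^{1/2},$$ $$G_D=\frac1{\sigma\sqrt{2\pi}}\int_{C_0b_D}^{C_1b_D}e^{-(t-b_D)^2/(2\sigma^2)}\,dt,$$ $$S=\Big\{D\in\mathbb N:\ C_{\alpha,\beta}\,\sigma\, b_D^{-1}\le 2,\ \ G_D\ge\big(1+4(1-\alpha-\beta)^2\big)^{-1/2}\Big\},\qquad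 M_2=\sup S .$$ Then, with the convention $\sup\emptyset=0$, $$\tilde r_{\varepsilon,\sigma}^2\ \ge\ \Big\{\frac{C_{\alpha,\beta}^2}{16}\,\sigma^2\,\sup_{D\in S}\big[b_D^{-2}a_D^{-2}\big]\Big\}\ \vee\ \Big\{\sup_{D\in\mathbb N}\Big[c_{\alpha,\beta}\,\varepsilon^2\sqrt{\textstyle\sum_{j=1}^D b_j^{-4}}\ \wedge\ a_D^{-2}\Big]\Big\}.$$ If $b$ is non-increasing, the same holds with the supremum over $D\in S$ replaced by the supremum over $1\le D\le M_2$. -/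

import Mathlib

open MeasureTheory ProbabilityTheory Set Filter
open scoped ENNReal

noncomputable section

namespace GSM

/-- The space `l²(ℕ)` of square-summable real sequences, indices starting at `1`. -/
abbrev L2 : Type := lp (fun _ : ℕ+ => ℝ) 2

/-- The observation space of the pair `(Y, X)` of real sequences. -/
abbrev Obs : Type := (ℕ+ → ℝ) × (ℕ+ → ℝ)

/-- The law of a sequence of independent standard Gaussian variables. -/
def stdNoise : Measure (ℕ+ → ℝ) := Measure.infinitePi fun _ => gaussianReal 0 1

/-- The joint law `P_{θ,b}` of `(Y, X)`, where `Y_j = b_j θ_j + ε ξ_j`, `X_j = b_j + σ η_j`, and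
`ξ`, `η` are independent standard Gaussian sequences. The values `ε = 0` and `σ = 0` are allowed:
the corresponding sequence is then observed without noise. -/
def law (ε σ : ℝ) (θ : L2) (b : ℕ+ → ℝ) : Measure Obs :=
  (stdNoise.prod stdNoise).map fun z =>
    ((fun j => b j * θ j + ε * z.1 j), (fun j => b j + σ * z.2 j))

/-- The ellipsoid `E_a = {θ ∈ l² : ∑ a_j² θ_j² ≤ 1}`. -/
def ellipsoid (a : ℕ+ → ℝ) : Set L2 :=
  {θ | Summable (fun j => a j ^ 2 * θ j ^ 2) ∧ ∑' j, a j ^ 2 * θ j ^ 2 ≤ 1}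

/-- `Θ_a(r)`: the ellipsoid with the ball of radius `r` removed. -/
def alternatives (a : ℕ+ → ℝ) (r : ℝ) : Set L2 := {θ | θ ∈ ellipsoid a ∧ r ≤ ‖θ‖}

/-- The benchmark signals of goodness-of-fit testing: the nonzero elements of the ellipsoid. -/
def benchmarks (a : ℕ+ → ℝ) : Set L2 := {θ₀ | θ₀ ∈ ellipsoid a ∧ θ₀ ≠ 0}

/-- `B(b)`: the sequences comparable to `b` with constants `C₀` and `C₁`. -/
def nearby (C₀ C₁ : ℝ) (b : ℕ+ → ℝ) : Set (ℕ+ → ℝ) :=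
  {ν | ∀ j, C₀ * |b j| ≤ |ν j| ∧ |ν j| ≤ C₁ * |b j|}

/-- A testing procedure: for each (known) benchmark `θ₀`, a measurable function `Ψ θ₀` of the
observation, whose value is the probability of rejecting `θ = θ₀`. The set of allowed values is
`V`: `V = {0, 1}` for non-randomized tests, `V = [0, 1]` for randomized tests. -/
structure IsTest (V : Set ℝ) (Ψ : L2 → Obs → ℝ) : Prop where
  measurable : ∀ θ₀, Measurable (Ψ θ₀)
  mem : ∀ θ₀ z, Ψ θ₀ z ∈ V

/-- First kind error probability, the benchmark ranging over `T` and the unknown sequence of the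
model over `B`. -/
def firstKind (T : Set L2) (B : Set (ℕ+ → ℝ)) (ε σ : ℝ) (Ψ : L2 → Obs → ℝ) : ℝ≥0∞ :=
  ⨆ θ₀ ∈ T, ⨆ b ∈ B, ∫⁻ z, ENNReal.ofReal (Ψ θ₀ z) ∂(law ε σ θ₀ b)

/-- Maximal second kind error probability at radius `r`, over `θ₀ ∈ T`, `θ - θ₀ ∈ Θ_a(r)` and
`b ∈ B`. -/
def secondKind (T : Set L2) (B : Set (ℕ+ → ℝ)) (a : ℕ+ → ℝ) (ε σ r : ℝ)
    (Ψ : L2 → Obs → ℝ) : ℝ≥0∞ :=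
  ⨆ θ₀ ∈ T, ⨆ θ : L2, ⨆ _ : θ - θ₀ ∈ alternatives a r, ⨆ b ∈ B,
    ∫⁻ z, ENNReal.ofReal (1 - Ψ θ₀ z) ∂(law ε σ θ b)

/-- The separation radius of a testing procedure. -/
def sepRadius (T : Set L2) (B : Set (ℕ+ → ℝ)) (a : ℕ+ → ℝ) (β ε σ : ℝ)
    (Ψ : L2 → Obs → ℝ) : ℝ≥0∞ :=
  ⨅ r : ℝ, ⨅ _ : 0 < r ∧ secondKind T B a ε σ r Ψ ≤ ENNReal.ofReal β, ENNReal.ofReal r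

/-- The minimax separation radius over the `α`-level tests with values in `V`. -/
def minimaxRadius (V : Set ℝ) (T : Set L2) (B : Set (ℕ+ → ℝ)) (a : ℕ+ → ℝ)
    (α β ε σ : ℝ) : ℝ≥0∞ :=
  ⨅ Ψ : L2 → Obs → ℝ, ⨅ _ : IsTest V Ψ ∧ firstKind T B ε σ Ψ ≤ ENNReal.ofReal α,
    sepRadius T B a β ε σ Ψ

/-- `C_{α,β} = ln (1 + 4 (1 - α - β)²)`. -/
def bigC (α β : ℝ) : ℝ := Real.log (1 + 4 * (1 - α - β) ^ 2)

/-- `c_{α,β} = (2 ln (1 + 4 (1 - α - β)²)) ^ (1/2)`. -/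
def smallC (α β : ℝ) : ℝ := Real.sqrt (2 * Real.log (1 + 4 * (1 - α - β) ^ 2))

/-- `G_D(C₀, C₁)`, the mass that the Gaussian law with mean `b_D` and variance `σ²` gives to
`[C₀ b_D, C₁ b_D]`. -/
def gaussMass (C₀ C₁ σ : ℝ) (b : ℕ+ → ℝ) (D : ℕ+) : ℝ :=
  1 / (σ * Real.sqrt (2 * Real.pi)) *
    ∫ t in (C₀ * b D)..(C₁ * b D), Real.exp (-(1 / (2 * σ ^ 2)) * (t - b D) ^ 2)

/-- The indices whose supremum is the bandwidth `M₂`. -/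
def admissible (C₀ C₁ α β σ : ℝ) (b : ℕ+ → ℝ) : Set ℕ+ :=
  {D | bigC α β * σ * (b D)⁻¹ ≤ 2 ∧
    1 / Real.sqrt (1 + 4 * (1 - α - β) ^ 2) ≤ gaussMass C₀ C₁ σ b D}

/-- The bandwidth `M₂`; it is `0` if no index is admissible and may be infinite. -/
def bandwidth (C₀ C₁ α β σ : ℝ) (b : ℕ+ → ℝ) : ℕ∞ :=
  ⨆ D ∈ admissible C₀ C₁ α β σ b, ((D : ℕ) : ℕ∞)

/-- The term `(C_{α,β}² / 16) σ² b_D⁻² a_D⁻²`. -/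
def sigmaTerm (a b : ℕ+ → ℝ) (α β σ : ℝ) (D : ℕ+) : ℝ≥0∞ :=
  ENNReal.ofReal (bigC α β ^ 2 / 16 * σ ^ 2 * ((b D ^ 2)⁻¹ * (a D ^ 2)⁻¹))

/-- The term `c_{α,β} ε² (∑_{j ≤ D} b_j⁻⁴) ^ (1/2) ∧ a_D⁻²`. -/
def epsTerm (a b : ℕ+ → ℝ) (α β ε : ℝ) (D : ℕ+) : ℝ≥0∞ :=
  ENNReal.ofReal (min
    (smallC α β * ε ^ 2 * Real.sqrt (∑ j ∈ Finset.Icc 1 D, (b j ^ 4)⁻¹)) ((a D ^ 2)⁻¹))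

end GSM

end

noncomputable section

namespace GSM

/-! Comparison: the noisy model arises from either extreme model by adding independent Gaussian
noise to the observation. Averaging a test over this added noise gives a randomized test in the
extreme model with the same errors (`minimaxRadius_le_of_randomization`); for known `b` one also
uses that `b` belongs to `nearby C₀ C₁ b`.

Explicit bounds: it remains to bound the extreme radii from below. Put `κ = 1 - α - β`. If the null
is tested against a finite mixture of translates whose chi-square divergence is below `4κ²`, some
alternative has total error above `1 - κ = α + β` (`exists_lt_integral_add_integral`). For known `b`
the mixture puts independent random signs on the first `D` coordinates
(`epsTerm_le_minimaxRadius_sq`). For noiseless `Y` only the products `b_j θ_j` are seen: enlarging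
`θ_D` and shrinking `b_D` by the same factor leaves `Y` unchanged, so that only the noisy `X` can
separate the hypotheses, and it sees a small shift of one coordinate
(`sigmaTerm_le_minimaxRadius_sq`). Admissibility of `D` serves only to make room in `[C₀ b_D, C₁
b_D]` for both values and to keep the perturbation in the ellipsoid. These conditions are monotone
in `b_D`, hence the extension to all `D ≤ M₂` for non-increasing `b`. -/

instance : IsProbabilityMeasure stdNoise := by unfold stdNoise; infer_instance

instance (ε σ : ℝ) (θ : L2) (b : ℕ+ → ℝ) : IsProbabilityMeasure (law ε σ θ b) :=
  Measure.isProbabilityMeasure_map (by fun_prop)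

/-! ### Translates of the Gaussian noise -/

/-- The density of the product measure of `ν` with respect to that of `μ`, if the factors differ
at finitely many indices only. -/
theorem infinitePi_withDensity_prod {ι : Type*} {X : ι → Type*} [∀ i, MeasurableSpace (X i)]
    (μ ν : (i : ι) → Measure (X i)) [∀ i, IsProbabilityMeasure (μ i)]
    [∀ i, IsProbabilityMeasure (ν i)] (g : (i : ι) → X i → ℝ≥0∞) (hg : ∀ i, Measurable (g i))
    (hν : ∀ i, (μ i).withDensity (g i) = ν i) (s : Finset ι) (hs : ∀ i ∉ s, g i = 1) :
    (Measure.infinitePi μ).withDensity (fun x => ∏ i ∈ s, g i (x i)) = Measure.infinitePi ν := by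
  classical
  refine Measure.eq_infinitePi _ fun u t ht => ?_
  have hmeas : MeasurableSet ((u : Set ι).pi t) := .pi u.countable_toSet fun _ _ => ht _
  rw [withDensity_apply _ hmeas, ← lintegral_indicator hmeas]
  -- Absorbing the indicator of the box into the factors makes the integrand a finite product over
  -- `s ∪ u`, which independence of the coordinates factorises.
  set G : (i : ι) → X i → ℝ≥0∞ := fun i => if i ∈ u then (t i).indicator (g i) else g i with hG
  have hGm : ∀ i, Measurable (G i) := by
    intro i
    by_cases hi : i ∈ u
    · simpa [hG, hi] using (hg i).indicator (ht i)
    · simpa [hG, hi] using hg i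
  have hprod : ∀ x : (i : ι) → X i,
      ((u : Set ι).pi t).indicator (fun x => ∏ i ∈ s, g i (x i)) x = ∏ i ∈ s ∪ u, G i (x i) := by
    intro x
    by_cases hx : x ∈ (u : Set ι).pi t
    · rw [indicator_of_mem hx]
      rw [Finset.prod_subset (f := fun i => g i (x i)) (Finset.subset_union_left (s₂ := u))
        (fun i _ hi => by rw [hs i hi]; rfl)]
      refine Finset.prod_congr rfl fun i _ => ?_
      by_cases hi : i ∈ u
      · simp [hG, hi, indicator_of_mem (hx i hi)]
      · simp [hG, hi]
    · rw [indicator_of_notMem hx]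
      obtain ⟨i, hi, hxi⟩ : ∃ i, i ∈ u ∧ x i ∉ t i := by simpa [Set.mem_pi] using hx
      refine (Finset.prod_eq_zero (Finset.mem_union_right s hi) ?_).symm
      simp [hG, hi, hxi]
  simp_rw [hprod]
  have hind : iIndepFun (fun i (x : (i : ι) → X i) => G i (x i)) (Measure.infinitePi μ) :=
    iIndepFun_infinitePi (fun i => hGm i)
  rw [lintegral_prod_eq_prod_lintegral_of_indepFun (s ∪ u) _ hind
    (fun i => (hGm i).comp (measurable_pi_apply i))]
  have hint : ∀ i, ∫⁻ x, G i (x i) ∂(Measure.infinitePi μ) = if i ∈ u then ν i (t i) else 1 := by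
    intro i
    rw [(measurePreserving_eval_infinitePi μ i).lintegral_comp (hGm i)]
    by_cases hi : i ∈ u
    · simp only [hG, hi, if_true]
      rw [lintegral_indicator (ht i), ← hν, withDensity_apply _ (ht i)]
    · simp only [hG, hi, if_false]
      rw [← setLIntegral_univ, ← withDensity_apply _ .univ, hν, measure_univ]
  simp_rw [hint, Finset.prod_ite_mem]
  simp

/-- The density of the noise translated by `h`, if `h` is supported in `s`. -/
def shiftDensity (s : Finset ℕ+) (h x : ℕ+ → ℝ) : ℝ :=
  Real.exp (∑ j ∈ s, (h j * x j - h j ^ 2 / 2))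

theorem shiftDensity_pos (s : Finset ℕ+) (h x : ℕ+ → ℝ) : 0 < shiftDensity s h x := Real.exp_pos _

@[fun_prop]
theorem measurable_shiftDensity (s : Finset ℕ+) (h : ℕ+ → ℝ) : Measurable (shiftDensity s h) := by
  unfold shiftDensity; fun_prop

/-- Completing the square. Since the density on the right integrates to one, the second moment of a
mixture density becomes a double sum of `exp ⟨h, k⟩`. -/
theorem shiftDensity_mul (s : Finset ℕ+) (h k x : ℕ+ → ℝ) :
    shiftDensity s h x * shiftDensity s k x =
      Real.exp (∑ j ∈ s, h j * k j) * shiftDensity s (h + k) x := by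
  simp only [shiftDensity, ← Real.exp_add, ← Finset.sum_add_distrib, Pi.add_apply]
  congr 1
  exact Finset.sum_congr rfl fun j _ => by ring

theorem gaussianReal_withDensity_exp (h : ℝ) :
    (gaussianReal 0 1).withDensity (fun x => ENNReal.ofReal (Real.exp (h * x - h ^ 2 / 2))) =
      gaussianReal h 1 := by
  rw [gaussianReal_of_var_ne_zero _ one_ne_zero, gaussianReal_of_var_ne_zero _ one_ne_zero,
    ← withDensity_mul _ (by fun_prop) (by fun_prop)]
  congr 1
  ext x
  simp only [Pi.mul_apply, gaussianPDF, gaussianPDFReal]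
  rw [← ENNReal.ofReal_mul (by positivity), mul_assoc, ← Real.exp_add]
  congr 3
  simp
  ring

/-- Cameron–Martin for a finitely supported shift: outside `s` the one-dimensional densities are
`exp 0 = 1`. -/
theorem stdNoise_map_add (s : Finset ℕ+) (h : ℕ+ → ℝ) (hs : ∀ j ∉ s, h j = 0) :
    stdNoise.map (fun x => x + h) =
      stdNoise.withDensity (fun x => ENNReal.ofReal (shiftDensity s h x)) := by
  have h1 : stdNoise.map (fun x => x + h) = Measure.infinitePi fun j => gaussianReal (h j) 1 := by
    have := Measure.infinitePi_map_pi (μ := fun _ : ℕ+ => gaussianReal 0 1)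
      (f := fun j x => x + h j) (fun j => by fun_prop)
    simp only [gaussianReal_map_add_const, zero_add] at this
    exact this
  rw [h1, ← infinitePi_withDensity_prod (fun _ => gaussianReal 0 1) _ _ (fun j => by fun_prop)
    (fun j => gaussianReal_withDensity_exp (h j)) s
    (fun j hj => by ext x; simp [hs j hj])]
  unfold stdNoise
  congr 1
  ext x
  rw [shiftDensity, Real.exp_sum, ENNReal.ofReal_prod_of_nonneg fun _ _ => (Real.exp_pos _).le]

theorem integral_add_eq_integral_shiftDensity_mul (s : Finset ℕ+) (h : ℕ+ → ℝ)
    (hs : ∀ j ∉ s, h j = 0) (f : (ℕ+ → ℝ) → ℝ) (hf : Measurable f) :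
    ∫ x, f (x + h) ∂stdNoise = ∫ x, shiftDensity s h x * f x ∂stdNoise := by
  rw [← integral_map (φ := fun x => x + h) (by fun_prop) hf.aestronglyMeasurable,
    stdNoise_map_add s h hs,
    integral_withDensity_eq_integral_toReal_smul (by fun_prop) (by simp)]
  simp [ENNReal.toReal_ofReal (shiftDensity_pos s h _).le]

theorem lintegral_shiftDensity (s : Finset ℕ+) (h : ℕ+ → ℝ) (hs : ∀ j ∉ s, h j = 0) :
    ∫⁻ x, ENNReal.ofReal (shiftDensity s h x) ∂stdNoise = 1 := by
  rw [← setLIntegral_univ, ← withDensity_apply _ .univ, ← stdNoise_map_add s h hs,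
    Measure.map_apply (by fun_prop) .univ]
  simp

theorem integrable_shiftDensity (s : Finset ℕ+) (h : ℕ+ → ℝ) (hs : ∀ j ∉ s, h j = 0) :
    Integrable (shiftDensity s h) stdNoise := by
  refine ⟨by fun_prop, ?_⟩
  rw [hasFiniteIntegral_iff_ofReal (.of_forall fun x => (shiftDensity_pos s h x).le),
    lintegral_shiftDensity s h hs]
  simp

theorem integral_shiftDensity (s : Finset ℕ+) (h : ℕ+ → ℝ) (hs : ∀ j ∉ s, h j = 0) :
    ∫ x, shiftDensity s h x ∂stdNoise = 1 := by
  rw [integral_eq_lintegral_of_nonneg_ae (.of_forall fun x => (shiftDensity_pos s h x).le)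
    (by fun_prop), lintegral_shiftDensity s h hs]
  simp

/-- The chi-square method: a test between the noise and a finite uniform mixture of its translates
has a large total error if the chi-square divergence is small. -/
theorem exists_lt_integral_add_integral {ι : Type*} [Fintype ι] [Nonempty ι] (s : Finset ℕ+)
    (h : ι → ℕ+ → ℝ) (hs : ∀ i, ∀ j ∉ s, h i j = 0) (f : (ℕ+ → ℝ) → ℝ) (hf : Measurable f)
    (hf01 : ∀ x, f x ∈ Icc (0 : ℝ) 1) (κ : ℝ) (hκ : 0 < κ)
    (hχ : ∑ i, ∑ k, Real.exp (∑ j ∈ s, h i j * h k j) <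
      (Fintype.card ι : ℝ) ^ 2 * (1 + 4 * κ ^ 2)) :
    ∃ i, 1 - κ < ∫ x, f x ∂stdNoise + ∫ x, (1 - f (x + h i)) ∂stdNoise := by
  set n : ℝ := (Fintype.card ι : ℝ) with hn
  have hn0 : 0 < n := by rw [hn]; exact_mod_cast Fintype.card_pos
  set L : (ℕ+ → ℝ) → ℝ := fun x => ∑ i, shiftDensity s (h i) x with hL
  have hsq : ∀ x, L x ^ 2 = ∑ i, ∑ k, Real.exp (∑ j ∈ s, h i j * h k j) *
      shiftDensity s (h i + h k) x := by
    intro x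
    simp only [hL, sq, Finset.sum_mul_sum, shiftDensity_mul]
  have hs2 : ∀ i k, ∀ j ∉ s, (h i + h k) j = 0 := fun i k j hj => by
    simp [hs i j hj, hs k j hj]
  have hLi : Integrable L stdNoise :=
    integrable_finsetSum _ fun i _ => integrable_shiftDensity s _ (hs i)
  have hL2i : Integrable (fun x => L x ^ 2) stdNoise := by
    simp_rw [hsq]
    exact integrable_finsetSum _ fun i _ => integrable_finsetSum _ fun k _ =>
      (integrable_shiftDensity s _ (hs2 i k)).const_mul _
  have hLint : ∫ x, L x ∂stdNoise = n := by
    simp only [hL]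
    rw [integral_finsetSum _ fun i _ => integrable_shiftDensity s _ (hs i)]
    simp [integral_shiftDensity s _ (hs _), hn]
  have hL2int : ∫ x, L x ^ 2 ∂stdNoise = ∑ i, ∑ k, Real.exp (∑ j ∈ s, h i j * h k j) := by
    simp_rw [hsq]
    rw [integral_finsetSum _ fun i _ => integrable_finsetSum _ fun k _ =>
      (integrable_shiftDensity s _ (hs2 i k)).const_mul _]
    refine Finset.sum_congr rfl fun i _ => ?_
    rw [integral_finsetSum _ fun k _ => (integrable_shiftDensity s _ (hs2 i k)).const_mul _]
    refine Finset.sum_congr rfl fun k _ => ?_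
    rw [integral_const_mul, integral_shiftDensity s _ (hs2 i k), mul_one]
  have hfb : ∀ x, ‖f x‖ ≤ 1 := fun x => by
    rw [Real.norm_eq_abs, abs_le]; constructor <;> linarith [(hf01 x).1, (hf01 x).2]
  have hfb' : ∀ x, ‖1 - f x‖ ≤ 1 := fun x => by
    rw [Real.norm_eq_abs, abs_le]; constructor <;> linarith [(hf01 x).1, (hf01 x).2]
  have hfi : Integrable f stdNoise :=
    Integrable.of_bound hf.aestronglyMeasurable 1 (.of_forall hfb)
  have hLf : ∀ i, Integrable (fun x => shiftDensity s (h i) x * (1 - f x)) stdNoise := fun i =>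
    (integrable_shiftDensity s _ (hs i)).mul_bdd (c := 1) (by fun_prop) (.of_forall hfb')
  have hsum : ∑ i, (∫ x, f x ∂stdNoise + ∫ x, (1 - f (x + h i)) ∂stdNoise) =
      ∫ x, (n * f x + L x * (1 - f x)) ∂stdNoise := by
    have hLf' : Integrable (fun x => L x * (1 - f x)) stdNoise := by
      simp only [hL, Finset.sum_mul]
      exact integrable_finsetSum _ fun i _ => hLf i
    rw [integral_add (hfi.const_mul n) hLf', integral_const_mul, Finset.sum_add_distrib]
    congr 1
    · simp [hn]
    · simp only [hL, Finset.sum_mul]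
      rw [integral_finsetSum _ fun i _ => hLf i]
      exact Finset.sum_congr rfl fun i _ =>
        integral_add_eq_integral_shiftDensity_mul s _ (hs i) (fun x => 1 - f x) (by fun_prop)
  -- Pointwise, `n f + L (1 - f) ≥ (n + L) / 2 - |L - n| / 2`, and AM-GM replaces `|L - n|` by its
  -- square. The weight `8κn` is chosen so that both error terms equal `κ n / 2` when the divergence
  -- is exactly `4κ²`.
  have hlow : ∫ x, ((n + L x) / 2 - (L x ^ 2 - 2 * n * L x + n ^ 2) / (8 * κ * n) - κ * n / 2)
      ∂stdNoise ≤ ∫ x, (n * f x + L x * (1 - f x)) ∂stdNoise := by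
    refine integral_mono (by fun_prop) ?_ fun x => ?_
    · refine (hfi.const_mul n).add ?_
      exact hLi.mul_bdd (c := 1) (by fun_prop) (.of_forall hfb')
    · have h1 : (L x ^ 2 - 2 * n * L x + n ^ 2) / (8 * κ * n) + κ * n / 2 ≥ |L x - n| / 2 := by
        rw [ge_iff_le, ← sub_nonneg]
        have : (L x ^ 2 - 2 * n * L x + n ^ 2) / (8 * κ * n) + κ * n / 2 - |L x - n| / 2 =
            (|L x - n| - 2 * κ * n) ^ 2 / (8 * κ * n) := by
          have : (|L x - n|) ^ 2 = L x ^ 2 - 2 * n * L x + n ^ 2 := by rw [sq_abs]; ring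
          rw [← this]
          field_simp
          ring
        rw [this]
        positivity
      have h2 : -(|L x - n| / 2) ≤ (f x - 1 / 2) * (n - L x) := by
        have h3 : |(f x - 1 / 2) * (n - L x)| ≤ 1 / 2 * |L x - n| := by
          rw [abs_mul, abs_sub_comm n]
          gcongr
          rw [abs_le]; constructor <;> linarith [(hf01 x).1, (hf01 x).2]
        have := neg_abs_le ((f x - 1 / 2) * (n - L x))
        linarith
      have h4 : n * f x + L x * (1 - f x) = (f x - 1 / 2) * (n - L x) + (n + L x) / 2 := by ring
      simp only []
      linarith
  have hval : ∫ x, ((n + L x) / 2 - (L x ^ 2 - 2 * n * L x + n ^ 2) / (8 * κ * n) - κ * n / 2)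
      ∂stdNoise = n - ((∫ x, L x ^ 2 ∂stdNoise) - n ^ 2) / (8 * κ * n) - κ * n / 2 := by
    rw [integral_sub (by fun_prop) (by fun_prop), integral_sub (by fun_prop) (by fun_prop),
      integral_div, integral_div, integral_add (by fun_prop) (by fun_prop),
      integral_add (by fun_prop) (by fun_prop), integral_sub (by fun_prop) (by fun_prop),
      integral_const_mul, hLint]
    simp
    ring
  rw [hval, hL2int, ← hsum] at hlow
  have hχ' : ((∑ i, ∑ k, Real.exp (∑ j ∈ s, h i j * h k j)) - n ^ 2) / (8 * κ * n) < κ * n / 2 := by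
    rw [div_lt_iff₀ (by positivity)]
    nlinarith
  -- The average over `i` of the total errors exceeds `1 - κ`, so one of them does.
  by_contra! hcon
  have := Finset.sum_le_sum fun i (_ : i ∈ Finset.univ) => hcon i
  simp only [Finset.sum_const, Finset.card_univ, nsmul_eq_mul] at this
  rw [← hn] at this
  linarith

/-! ### The extreme models, and the comparison of the minimax radii -/

theorem law_zero_right (ε : ℝ) (θ : L2) (b : ℕ+ → ℝ) :
    law ε 0 θ b = stdNoise.map fun x => ((fun j => b j * θ j + ε * x j), b) := by
  have h : stdNoise = (stdNoise.prod stdNoise).map Prod.fst := by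
    rw [Measure.map_fst_prod]; simp
  conv_rhs => rw [h]
  rw [Measure.map_map (by fun_prop) (by fun_prop)]
  simp [law, Function.comp_def]

theorem law_zero_left (σ : ℝ) (θ : L2) (b : ℕ+ → ℝ) :
    law 0 σ θ b = stdNoise.map fun x => ((fun j => b j * θ j), (fun j => b j + σ * x j)) := by
  have h : stdNoise = (stdNoise.prod stdNoise).map Prod.snd := by
    rw [Measure.map_snd_prod]; simp
  conv_rhs => rw [h]
  rw [Measure.map_map (by fun_prop) (by fun_prop)]
  simp [law, Function.comp_def]

theorem integral_law_zero_right (ε : ℝ) (θ : L2) (b : ℕ+ → ℝ) {f : Obs → ℝ} (hf : Measurable f) :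
    ∫ z, f z ∂(law ε 0 θ b) = ∫ x, f ((fun j => b j * θ j + ε * x j), b) ∂stdNoise := by
  rw [law_zero_right, integral_map ?_ hf.aestronglyMeasurable]
  exact Measurable.aemeasurable (by fun_prop)

theorem integral_law_zero_left (σ : ℝ) (θ : L2) (b : ℕ+ → ℝ) {f : Obs → ℝ} (hf : Measurable f) :
    ∫ z, f z ∂(law 0 σ θ b) =
      ∫ x, f ((fun j => b j * θ j), (fun j => b j + σ * x j)) ∂stdNoise := by
  rw [law_zero_left, integral_map ?_ hf.aestronglyMeasurable]
  exact Measurable.aemeasurable (by fun_prop)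

theorem law_eq_map_law_zero_right (ε σ : ℝ) (θ : L2) (b : ℕ+ → ℝ) :
    law ε σ θ b = (stdNoise.prod (law ε 0 θ b)).map
      fun p => (p.2.1, fun j => p.2.2 j + σ * p.1 j) := by
  rw [law_zero_right]
  nth_rw 1 [← Measure.map_id (μ := stdNoise)]
  rw [Measure.map_prod_map _ _ measurable_id (by fun_prop),
    Measure.map_map (by fun_prop) (by fun_prop)]
  -- In `law` the noise of `X` is the second factor, whereas the added noise comes first here.
  conv_lhs => rw [law, ← Measure.prod_swap, Measure.map_map (by fun_prop) (by fun_prop)]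
  rfl

theorem law_eq_map_law_zero_left (ε σ : ℝ) (θ : L2) (b : ℕ+ → ℝ) :
    law ε σ θ b = (stdNoise.prod (law 0 σ θ b)).map
      fun p => ((fun j => p.2.1 j + ε * p.1 j), p.2.2) := by
  rw [law_zero_left]
  nth_rw 1 [← Measure.map_id (μ := stdNoise)]
  rw [Measure.map_prod_map _ _ measurable_id (by fun_prop),
    Measure.map_map (by fun_prop) (by fun_prop), law]
  rfl

theorem subset_Icc_of_eq {V : Set ℝ} (hV : V = {0, 1} ∨ V = Icc 0 1) : V ⊆ Icc 0 1 := by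
  rcases hV with rfl | rfl
  · rintro x (rfl | rfl) <;> simp
  · exact Subset.rfl

theorem IsTest.mono {V W : Set ℝ} (hVW : V ⊆ W) {Ψ : L2 → Obs → ℝ} (h : IsTest V Ψ) :
    IsTest W Ψ :=
  ⟨h.measurable, fun θ₀ z => hVW (h.mem θ₀ z)⟩

theorem integrable_of_mem_Icc {Ω : Type*} [MeasurableSpace Ω] (μ : Measure Ω) [IsFiniteMeasure μ]
    {f : Ω → ℝ} (hf : Measurable f) (h : ∀ x, f x ∈ Icc (0 : ℝ) 1) : Integrable f μ :=
  Integrable.of_bound hf.aestronglyMeasurable 1 (.of_forall fun x => by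
    rw [Real.norm_eq_abs, abs_of_nonneg (h x).1]; exact (h x).2)

theorem lintegral_ofReal_integral {Ω Ω' : Type*} [MeasurableSpace Ω] [MeasurableSpace Ω']
    (μ : Measure Ω) (P : Measure Ω') [IsProbabilityMeasure μ] [IsProbabilityMeasure P]
    (F : Ω × Ω' → ℝ) (hF : Measurable F) (hF01 : ∀ p, F p ∈ Icc (0 : ℝ) 1) :
    ∫⁻ z, ENNReal.ofReal (∫ ω, F (ω, z) ∂μ) ∂P = ∫⁻ p, ENNReal.ofReal (F p) ∂(μ.prod P) := by
  rw [lintegral_prod_symm _ (by fun_prop)]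
  refine lintegral_congr fun z => ?_
  exact ofReal_integral_eq_lintegral_ofReal
    (integrable_of_mem_Icc μ (by fun_prop) fun ω => hF01 _) (.of_forall fun ω => (hF01 _).1)

/-- If the observation in one model is obtained from that in another by randomization, then the
minimax radius of the first is at least that of the second. -/
theorem minimaxRadius_le_of_randomization {V : Set ℝ} (hV : V ⊆ Icc 0 1) (T : Set L2)
    {B B' : Set (ℕ+ → ℝ)} (hB : B' ⊆ B) (a : ℕ+ → ℝ) (α β : ℝ) {ε σ ε' σ' : ℝ} {Ω : Type*}
    [MeasurableSpace Ω] (μ : Measure Ω) [IsProbabilityMeasure μ] (F : Ω × Obs → Obs)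
    (hF : Measurable F)
    (hlaw : ∀ θ b, law ε σ θ b = (μ.prod (law ε' σ' θ b)).map F) :
    minimaxRadius (Icc 0 1) T B' a α β ε' σ' ≤ minimaxRadius V T B a α β ε σ := by
  refine le_iInf₂ fun Ψ hΨ => ?_
  obtain ⟨hΨt, hΨ1⟩ := hΨ
  replace hΨt := hΨt.mono hV
  -- The conditional expectation of `Ψ` given the less noisy observation. Its values fill `[0, 1]`
  -- even if `Ψ` is non-randomized, so the extreme radii are taken over randomized tests.
  set Φ : L2 → Obs → ℝ := fun θ₀ z => ∫ ω, Ψ θ₀ (F (ω, z)) ∂μ with hΦ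
  have hm : ∀ θ₀, Measurable fun p => Ψ θ₀ (F p) := fun θ₀ => (hΨt.measurable θ₀).comp hF
  have hint : ∀ θ₀ z, Integrable (fun ω => Ψ θ₀ (F (ω, z))) μ := fun θ₀ z =>
    integrable_of_mem_Icc μ ((hm θ₀).comp (by fun_prop)) fun ω => hΨt.mem _ _
  have hΦt : IsTest (Icc 0 1) Φ := by
    refine ⟨fun θ₀ => ?_, fun θ₀ z => ⟨integral_nonneg fun ω => (hΨt.mem _ _).1, ?_⟩⟩
    · exact ((hm θ₀).stronglyMeasurable.integral_prod_left').measurable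
    · have := integral_mono (hint θ₀ z) (integrable_const (1 : ℝ))
        fun ω => (hΨt.mem θ₀ (F (ω, z))).2
      simpa using this
  have hI : ∀ (θ₀ θ : L2) (b : ℕ+ → ℝ), ∫⁻ z, ENNReal.ofReal (Φ θ₀ z) ∂(law ε' σ' θ b) =
      ∫⁻ z, ENNReal.ofReal (Ψ θ₀ z) ∂(law ε σ θ b) := by
    intro θ₀ θ b
    rw [hlaw, lintegral_map ((hΨt.measurable θ₀).ennreal_ofReal) hF]
    exact lintegral_ofReal_integral μ _ (fun p => Ψ θ₀ (F p)) (hm θ₀) fun p => hΨt.mem _ _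
  have hII : ∀ (θ₀ θ : L2) (b : ℕ+ → ℝ), ∫⁻ z, ENNReal.ofReal (1 - Φ θ₀ z) ∂(law ε' σ' θ b) =
      ∫⁻ z, ENNReal.ofReal (1 - Ψ θ₀ z) ∂(law ε σ θ b) := by
    intro θ₀ θ b
    rw [hlaw, lintegral_map ((hΨt.measurable θ₀).const_sub 1).ennreal_ofReal hF,
      ← lintegral_ofReal_integral μ _ (fun p => 1 - Ψ θ₀ (F p)) ((hm θ₀).const_sub 1)
        fun p => ⟨by linarith [(hΨt.mem θ₀ (F p)).2], by linarith [(hΨt.mem θ₀ (F p)).1]⟩]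
    refine lintegral_congr fun z => ?_
    rw [integral_sub (integrable_const _) (hint θ₀ z)]
    simp [hΦ]
  have hfirst : firstKind T B' ε' σ' Φ ≤ ENNReal.ofReal α := by
    refine le_trans ?_ hΨ1
    simp only [firstKind, hI]
    exact iSup₂_mono fun θ₀ _ => biSup_mono hB
  refine iInf₂_le_of_le Φ ⟨hΦt, hfirst⟩ (le_iInf₂ fun r hr => iInf₂_le_of_le r ⟨hr.1, ?_⟩ le_rfl)
  refine le_trans ?_ hr.2
  simp only [secondKind, hII]
  exact iSup₂_mono fun θ₀ _ => iSup₂_mono fun θ _ => biSup_mono hB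

theorem mem_nearby_self {C₀ C₁ : ℝ} (hC₀ : C₀ ≤ 1) (hC₁ : 1 ≤ C₁) (b : ℕ+ → ℝ) :
    b ∈ nearby C₀ C₁ b := fun _ =>
  ⟨mul_le_of_le_one_left (abs_nonneg _) hC₀, le_mul_of_one_le_left (abs_nonneg _) hC₁⟩

theorem minimaxRadius_zero_left_le {V : Set ℝ} (hV : V ⊆ Icc 0 1) (T : Set L2)
    (B : Set (ℕ+ → ℝ)) (a : ℕ+ → ℝ) (α β ε σ : ℝ) :
    minimaxRadius (Icc 0 1) T B a α β 0 σ ≤ minimaxRadius V T B a α β ε σ :=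
  minimaxRadius_le_of_randomization hV T Subset.rfl a α β stdNoise _ (by fun_prop)
    fun θ b => law_eq_map_law_zero_left ε σ θ b

theorem minimaxRadius_zero_right_le {V : Set ℝ} (hV : V ⊆ Icc 0 1) (T : Set L2)
    {B B' : Set (ℕ+ → ℝ)} (hB : B' ⊆ B) (a : ℕ+ → ℝ) (α β ε σ : ℝ) :
    minimaxRadius (Icc 0 1) T B' a α β ε 0 ≤ minimaxRadius V T B a α β ε σ :=
  minimaxRadius_le_of_randomization hV T hB a α β stdNoise _ (by fun_prop)
    fun θ b => law_eq_map_law_zero_right ε σ θ b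

/-! ### Error probabilities of a single pair of hypotheses -/

theorem integral_le_of_firstKind_le {Ψ : L2 → Obs → ℝ} (hΨ : IsTest (Icc 0 1) Ψ) {T : Set L2}
    {B : Set (ℕ+ → ℝ)} {ε σ α : ℝ} (hα : 0 ≤ α) (h : firstKind T B ε σ Ψ ≤ ENNReal.ofReal α)
    {θ₀ : L2} (hθ₀ : θ₀ ∈ T) {b : ℕ+ → ℝ} (hb : b ∈ B) :
    ∫ z, Ψ θ₀ z ∂(law ε σ θ₀ b) ≤ α := by
  rw [← ENNReal.ofReal_le_ofReal_iff hα, ofReal_integral_eq_lintegral_ofReal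
    (integrable_of_mem_Icc _ (hΨ.measurable θ₀) (hΨ.mem θ₀))
    (.of_forall fun z => (hΨ.mem θ₀ z).1)]
  refine le_trans ?_ h
  exact le_iSup₂_of_le θ₀ hθ₀ (le_iSup₂_of_le b hb le_rfl)

theorem integral_le_of_secondKind_le {Ψ : L2 → Obs → ℝ} (hΨ : IsTest (Icc 0 1) Ψ) {T : Set L2}
    {B : Set (ℕ+ → ℝ)} {a : ℕ+ → ℝ} {ε σ β r : ℝ} (hβ : 0 ≤ β)
    (h : secondKind T B a ε σ r Ψ ≤ ENNReal.ofReal β) {θ₀ θ : L2} (hθ₀ : θ₀ ∈ T)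
    (hθ : θ - θ₀ ∈ alternatives a r) {b : ℕ+ → ℝ} (hb : b ∈ B) :
    ∫ z, (1 - Ψ θ₀ z) ∂(law ε σ θ b) ≤ β := by
  have h01 : ∀ z, 1 - Ψ θ₀ z ∈ Icc (0 : ℝ) 1 := fun z =>
    ⟨by linarith [(hΨ.mem θ₀ z).2], by linarith [(hΨ.mem θ₀ z).1]⟩
  rw [← ENNReal.ofReal_le_ofReal_iff hβ, ofReal_integral_eq_lintegral_ofReal
    (integrable_of_mem_Icc _ ((hΨ.measurable θ₀).const_sub 1) h01)
    (.of_forall fun z => (h01 z).1)]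
  refine le_trans ?_ h
  exact le_iSup₂_of_le θ₀ hθ₀ (le_iSup₂_of_le θ hθ (le_iSup₂_of_le b hb le_rfl))

theorem ofReal_le_minimaxRadius_sq (V : Set ℝ) (T : Set L2) (B : Set (ℕ+ → ℝ)) (a : ℕ+ → ℝ)
    (α β ε σ R : ℝ)
    (h : ∀ Ψ, IsTest V Ψ → firstKind T B ε σ Ψ ≤ ENNReal.ofReal α → ∀ r, 0 < r →
      secondKind T B a ε σ r Ψ ≤ ENNReal.ofReal β → R ≤ r ^ 2) :
    ENNReal.ofReal R ≤ minimaxRadius V T B a α β ε σ ^ 2 := by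
  calc ENNReal.ofReal R ≤ ENNReal.ofReal (Real.sqrt R ^ 2) :=
        ENNReal.ofReal_le_ofReal (by
          -- For negative `R`, `Real.sqrt R` is `0` and the bound is trivial.
          rcases le_total 0 R with h0 | h0
          · rw [Real.sq_sqrt h0]
          · exact h0.trans (sq_nonneg _))
    _ = ENNReal.ofReal (Real.sqrt R) ^ 2 := ENNReal.ofReal_pow (Real.sqrt_nonneg _) _
    _ ≤ minimaxRadius V T B a α β ε σ ^ 2 := by
        gcongr
        refine le_iInf₂ fun Ψ hΨ => le_iInf₂ fun r hr => ENNReal.ofReal_le_ofReal ?_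
        exact (Real.sqrt_le_left hr.1.le).2 (h Ψ hΨ.1 hΨ.2 r hr.1 hr.2)

/-! ### Finitely supported signals -/

/-- The signal with coordinates `v j` for `j ∈ s` and `0` elsewhere. -/
def finSignal (s : Finset ℕ+) (v : ℕ+ → ℝ) : L2 :=
  ⟨fun j => if j ∈ s then v j else 0, memℓp_gen <| summable_of_ne_finset_zero (s := s)
    fun j hj => by simp [hj]⟩

@[simp]
theorem finSignal_apply (s : Finset ℕ+) (v : ℕ+ → ℝ) (j : ℕ+) :
    finSignal s v j = if j ∈ s then v j else 0 := rfl

theorem norm_finSignal_sq (s : Finset ℕ+) (v : ℕ+ → ℝ) :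
    ‖finSignal s v‖ ^ 2 = ∑ j ∈ s, v j ^ 2 := by
  have h := lp.norm_rpow_eq_tsum (p := 2) (by simp) (finSignal s v)
  simp only [ENNReal.toReal_ofNat, Real.rpow_two] at h
  rw [h, tsum_eq_sum (s := s) fun j hj => by simp [hj]]
  exact Finset.sum_congr rfl fun j hj => by simp [hj]

theorem finSignal_mem_ellipsoid {a : ℕ+ → ℝ} {s : Finset ℕ+} {v : ℕ+ → ℝ}
    (h : ∑ j ∈ s, a j ^ 2 * v j ^ 2 ≤ 1) : finSignal s v ∈ ellipsoid a := by
  have h0 : ∀ j ∉ s, a j ^ 2 * finSignal s v j ^ 2 = 0 := fun j hj => by simp [hj]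
  refine ⟨summable_of_ne_finset_zero h0, ?_⟩
  rw [tsum_eq_sum h0]
  refine le_trans (le_of_eq ?_) h
  exact Finset.sum_congr rfl fun j hj => by simp [hj]

theorem finSignal_mem_alternatives {a : ℕ+ → ℝ} {s : Finset ℕ+} {v : ℕ+ → ℝ} {r : ℝ}
    (h : ∑ j ∈ s, a j ^ 2 * v j ^ 2 ≤ 1) (hr : r ^ 2 ≤ ∑ j ∈ s, v j ^ 2) :
    finSignal s v ∈ alternatives a r :=
  ⟨finSignal_mem_ellipsoid h, le_of_sq_le_sq (by rwa [norm_finSignal_sq]) (norm_nonneg _)⟩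

theorem finSignal_singleton_mem_benchmarks {a : ℕ+ → ℝ} {D : ℕ+} (hD : 0 < a D) :
    finSignal {D} (fun _ => (a D)⁻¹) ∈ benchmarks a := by
  refine ⟨finSignal_mem_ellipsoid (by simp [hD.ne']), fun h => ?_⟩
  have := norm_finSignal_sq {D} (fun _ => (a D)⁻¹)
  rw [h] at this
  have hpos : 0 < a D ^ 2 := by positivity
  simp at this
  linarith

/-! ### The lower bound for a known sequence -/

/-- The sum over `t` factorises over coordinates, and each factor is `exp (c j) + exp (-c j)`
whatever the sign `s j`. The inner sum of the chi-square double sum is thus independent of `s`. -/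
theorem sum_exp_sum_sign (D : Finset ℕ+) (c : ℕ+ → ℝ) (s : D → Bool) :
    ∑ t : D → Bool, Real.exp (∑ j : D, c j * ((if s j then 1 else -1) * (if t j then 1 else -1))) =
      (Fintype.card (D → Bool) : ℝ) * ∏ j ∈ D, Real.cosh (c j) := by
  simp_rw [Real.exp_sum]
  rw [← Fintype.prod_sum (f := fun (j : D) (u : Bool) =>
    Real.exp (c j * ((if s j then 1 else -1) * (if u then 1 else -1))))]
  have h : ∀ j : D, ∑ u : Bool, Real.exp (c j * ((if s j then 1 else -1) * (if u then 1 else -1))) =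
      2 * Real.cosh (c j) := by
    intro j
    rw [Real.cosh_eq]
    cases s j <;> simp <;> ring
  simp_rw [h]
  rw [Finset.prod_mul_distrib, Finset.univ_eq_attach, Finset.prod_attach D (fun j => Real.cosh (c j))]
  simp

theorem prod_cosh_le_exp (D : Finset ℕ+) (c : ℕ+ → ℝ) :
    ∏ j ∈ D, Real.cosh (c j) ≤ Real.exp (∑ j ∈ D, c j ^ 2 / 2) := by
  rw [Real.exp_sum]
  exact Finset.prod_le_prod (fun j _ => (Real.cosh_pos _).le) fun j _ =>
    Real.cosh_le_exp_half_sq _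

theorem epsTerm_le_minimaxRadius_sq (a b : ℕ+ → ℝ) (ha_pos : ∀ j, 0 < a j) (ha_mono : Monotone a)
    (hb_pos : ∀ j, 0 < b j) (α β : ℝ) (hα : 0 ≤ α) (hβ : 0 ≤ β) (hαβ : α + β < 1) (ε : ℝ)
    (hε : 0 < ε) (D : ℕ+) :
    epsTerm a b α β ε D ≤ minimaxRadius (Icc 0 1) (benchmarks a) {b} a α β ε 0 ^ 2 := by
  refine ofReal_le_minimaxRadius_sq _ _ _ _ _ _ _ _ _ fun Ψ hΨ h1 r hr h2 => ?_
  by_contra! hlt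
  set s : Finset ℕ+ := Finset.Icc 1 D with hs
  have hDs : D ∈ s := by simp [hs]
  set W : ℝ := ∑ j ∈ s, (b j ^ 4)⁻¹ with hW
  have hW0 : 0 < W := Finset.sum_pos (fun j _ => by have := hb_pos j; positivity) ⟨D, hDs⟩
  have hκ : 0 < 1 - α - β := by linarith
  obtain ⟨hltε, hlta⟩ := lt_min_iff.1 hlt
  -- Any benchmark would do: with `b` known, `θ₀` only recentres `Y`.
  set θ₀ : L2 := finSignal {1} (fun _ => (a 1)⁻¹) with hθ₀
  have hθ₀b : θ₀ ∈ benchmarks a := finSignal_singleton_mem_benchmarks (ha_pos 1)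
  set sg : Bool → ℝ := fun u => if u then 1 else -1 with hsg
  have hsg2 : ∀ u, sg u ^ 2 = 1 := by rintro (_ | _) <;> simp [hsg]
  -- By Cauchy–Schwarz, amplitudes proportional to `b_j⁻²` minimise `∑ b_j⁴ ρ_j⁴` among those with
  -- `∑ ρ_j² = r²`; the minimum is `r⁴ / W`.
  set ρ : ℕ+ → ℝ := fun j => r / Real.sqrt W * (b j ^ 2)⁻¹ with hρ
  have hρ2 : ∀ j, ρ j ^ 2 = r ^ 2 / W * (b j ^ 4)⁻¹ := by
    intro j
    simp only [hρ]
    rw [mul_pow, div_pow, Real.sq_sqrt hW0.le, inv_pow, ← pow_mul]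
  have hρsum : ∑ j ∈ s, ρ j ^ 2 = r ^ 2 := by
    simp_rw [hρ2]
    rw [← Finset.mul_sum, ← hW]
    field_simp
  set v : (s → Bool) → ℕ+ → ℝ := fun w j => if hj : j ∈ s then sg (w ⟨j, hj⟩) * ρ j else 0 with hv
  have hv2 : ∀ w, ∀ j ∈ s, v w j ^ 2 = ρ j ^ 2 := by
    intro w j hj
    simp only [hv, hj, dif_pos, mul_pow, hsg2, one_mul]
  set h : (s → Bool) → ℕ+ → ℝ := fun w j => b j * v w j / ε with hh
  have hsupp : ∀ w, ∀ j ∉ s, h w j = 0 := by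
    intro w j hj
    simp [hh, hv, hj]
  have hdiv : ∑ w, ∑ w', Real.exp (∑ j ∈ s, h w j * h w' j) <
      (Fintype.card (s → Bool) : ℝ) ^ 2 * (1 + 4 * (1 - α - β) ^ 2) := by
    have hinner : ∀ w w', ∑ j ∈ s, h w j * h w' j =
        ∑ j : s, (b j * ρ j / ε) ^ 2 * ((if w j then 1 else -1) * (if w' j then 1 else -1)) := by
      intro w w'
      rw [← Finset.sum_coe_sort s]
      refine Finset.sum_congr rfl fun j _ => ?_
      simp only [hh, hv, hsg, j.2, dif_pos]
      ring
    simp_rw [hinner]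
    simp_rw [sum_exp_sum_sign s (fun j => (b j * ρ j / ε) ^ 2)]
    rw [Finset.sum_const, Finset.card_univ, nsmul_eq_mul, ← mul_assoc, ← sq]
    refine mul_lt_mul_of_pos_left ?_ (by positivity)
    -- From `cosh x ≤ exp (x² / 2)` the divergence condition reduces to `r⁴ / (2 ε⁴ W) < ln (1 +
    -- 4κ²)`, which is `r² < c_{α,β} ε² √W`.
    refine (prod_cosh_le_exp s _).trans_lt ?_
    rw [← Real.lt_log_iff_exp_lt (by positivity)]
    have hsum : ∑ j ∈ s, ((b j * ρ j / ε) ^ 2) ^ 2 / 2 = (r ^ 2) ^ 2 / (2 * ε ^ 4 * W) := by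
      have : ∀ j ∈ s, ((b j * ρ j / ε) ^ 2) ^ 2 / 2 =
          (r ^ 2) ^ 2 / (2 * ε ^ 4 * W ^ 2) * (b j ^ 4)⁻¹ := by
        intro j _
        have hb := hb_pos j
        rw [div_pow, mul_pow, hρ2]
        field_simp
      rw [Finset.sum_congr rfl this, ← Finset.mul_sum, ← hW]
      field_simp
    rw [hsum, div_lt_iff₀ (by positivity)]
    have hl : 0 ≤ 2 * Real.log (1 + 4 * (1 - α - β) ^ 2) :=
      mul_nonneg zero_le_two (Real.log_nonneg (by nlinarith))
    calc (r ^ 2) ^ 2 < (smallC α β * ε ^ 2 * Real.sqrt W) ^ 2 :=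
          pow_lt_pow_left₀ hltε (sq_nonneg r) two_ne_zero
      _ = Real.log (1 + 4 * (1 - α - β) ^ 2) * (2 * ε ^ 4 * W) := by
          rw [mul_pow, mul_pow, Real.sq_sqrt hW0.le, smallC, Real.sq_sqrt hl]
          ring
  obtain ⟨w, hw⟩ := exists_lt_integral_add_integral s h hsupp
    (fun x => Ψ θ₀ ((fun j => b j * θ₀ j + ε * x j), b))
    ((hΨ.measurable θ₀).comp (by fun_prop)) (fun x => hΨ.mem _ _) _ hκ hdiv
  have halt : (θ₀ + finSignal s (v w)) - θ₀ ∈ alternatives a r := by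
    rw [add_sub_cancel_left]
    refine finSignal_mem_alternatives ?_ ?_
    · calc ∑ j ∈ s, a j ^ 2 * v w j ^ 2 ≤ ∑ j ∈ s, a D ^ 2 * ρ j ^ 2 := by
            refine Finset.sum_le_sum fun j hj => ?_
            rw [hv2 w j hj]
            have := ha_mono (Finset.mem_Icc.1 hj).2
            have := (ha_pos j).le
            gcongr
        _ = a D ^ 2 * r ^ 2 := by rw [← Finset.mul_sum, hρsum]
        _ ≤ a D ^ 2 * (a D ^ 2)⁻¹ := by gcongr
        _ = 1 := mul_inv_cancel₀ (by have := ha_pos D; positivity)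
    · rw [Finset.sum_congr rfl (hv2 w), hρsum]
  have e1 := integral_le_of_firstKind_le hΨ hα h1 hθ₀b (mem_singleton b)
  have e2 := integral_le_of_secondKind_le hΨ hβ h2 hθ₀b halt (mem_singleton b)
  rw [integral_law_zero_right _ _ _ (hΨ.measurable θ₀)] at e1
  rw [integral_law_zero_right _ _ _ ((hΨ.measurable θ₀).const_sub 1)] at e2
  have hY : ∀ x : ℕ+ → ℝ, (fun j => b j * (θ₀ + finSignal s (v w) : L2) j + ε * x j) =
      fun j => b j * θ₀ j + ε * (x + h w) j := by
    intro x
    ext j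
    simp only [lp.coeFn_add, Pi.add_apply, finSignal_apply, hh]
    by_cases hj : j ∈ s
    · simp only [hj, if_true]
      field_simp
      ring
    · simp [hj, hv]
  simp_rw [hY] at e2
  linarith

/-! ### The lower bound for noiseless `Y` -/

theorem bigC_pos {α β : ℝ} (hαβ : α + β < 1) : 0 < bigC α β :=
  Real.log_pos (by have : 0 < 1 - α - β := by linarith
                   nlinarith)

/-- Here `κ ≤ 1`, so `ln (1 + 4κ²) ≤ 4κ² ≤ 4`. -/
theorem bigC_le_four {α β : ℝ} (hα : 0 ≤ α) (hβ : 0 ≤ β) (hαβ : α + β < 1) : bigC α β ≤ 4 := by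
  have := Real.log_le_sub_one_of_pos (x := 1 + 4 * (1 - α - β) ^ 2) (by positivity)
  unfold bigC
  nlinarith

theorem gaussMass_le {C₀ C₁ σ : ℝ} {b : ℕ+ → ℝ} {D : ℕ+} (hσ : 0 < σ)
    (h : C₀ * b D ≤ C₁ * b D) :
    gaussMass C₀ C₁ σ b D ≤ 1 / (σ * Real.sqrt (2 * Real.pi)) * ((C₁ - C₀) * b D) := by
  unfold gaussMass
  gcongr
  calc ∫ t in (C₀ * b D)..(C₁ * b D), Real.exp (-(1 / (2 * σ ^ 2)) * (t - b D) ^ 2)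
      ≤ ∫ _ in (C₀ * b D)..(C₁ * b D), (1 : ℝ) := by
        refine intervalIntegral.integral_mono_on h
          (Continuous.intervalIntegrable (by fun_prop) _ _) (by simp) fun t _ => ?_
        rw [Real.exp_le_one_iff, neg_mul, neg_nonpos]
        positivity
    _ = (C₁ - C₀) * b D := by simp; ring

/-- The integrand of `G_D` is at most `1`, so a large `G_D` forces the interval `[C₀ b_D, C₁ b_D]`
to have length at least `σ ≥ C_{α,β} σ / 4`. Both conclusions persist when `b_D` grows. -/
theorem le_of_mem_admissible {C₀ C₁ α β σ : ℝ} {b : ℕ+ → ℝ} {D : ℕ+} (hb : 0 < b D)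
    (hC₀_le : C₀ ≤ 1) (hC₁_ge : 1 ≤ C₁) (hσ : 0 < σ) (hα : 0 ≤ α) (hβ : 0 ≤ β)
    (hαβ : α + β < 1) (hD : D ∈ admissible C₀ C₁ α β σ b) :
    bigC α β * σ ≤ 2 * b D ∧ bigC α β * σ / 4 ≤ (C₁ - C₀) * b D := by
  obtain ⟨hD1, hD2⟩ := hD
  refine ⟨by rwa [← div_eq_mul_inv, div_le_iff₀ hb] at hD1, ?_⟩
  have hC := bigC_le_four hα hβ hαβ
  -- `1 + 4κ² ≤ 5 < 6 < 2π`.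
  have hπ : Real.sqrt (1 + 4 * (1 - α - β) ^ 2) ≤ Real.sqrt (2 * Real.pi) :=
    Real.sqrt_le_sqrt (by nlinarith [Real.pi_gt_three])
  have h1 := hD2.trans (gaussMass_le hσ (by gcongr; linarith))
  have hs : 0 < Real.sqrt (1 + 4 * (1 - α - β) ^ 2) := Real.sqrt_pos.2 (by positivity)
  rw [one_div_mul_eq_div, div_le_div_iff₀ hs (by positivity), one_mul] at h1
  have hb' : 0 ≤ (C₁ - C₀) * b D := mul_nonneg (by linarith) hb.le
  have h2 : σ * Real.sqrt (1 + 4 * (1 - α - β) ^ 2) ≤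
      (C₁ - C₀) * b D * Real.sqrt (1 + 4 * (1 - α - β) ^ 2) := by
    refine le_trans ?_ h1
    gcongr
  have h3 := le_of_mul_le_mul_right h2 hs
  nlinarith

theorem sigmaTerm_le_minimaxRadius_sq (a b : ℕ+ → ℝ) (ha_pos : ∀ j, 0 < a j)
    (hb_pos : ∀ j, 0 < b j) {C₀ C₁ : ℝ} (hC₀ : 0 < C₀) (hC₀_le : C₀ ≤ 1) (hC₁_ge : 1 ≤ C₁)
    (α β : ℝ) (hα : 0 ≤ α) (hβ : 0 ≤ β) (hαβ : α + β < 1) (σ : ℝ) (hσ : 0 < σ) (D : ℕ+)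
    (hD1 : bigC α β * σ ≤ 2 * b D) (hD2 : bigC α β * σ / 4 ≤ (C₁ - C₀) * b D) :
    sigmaTerm a b α β σ D ≤
      minimaxRadius (Icc 0 1) (benchmarks a) (nearby C₀ C₁ b) a α β 0 σ ^ 2 := by
  refine ofReal_le_minimaxRadius_sq _ _ _ _ _ _ _ _ _ fun Ψ hΨ h1 r hr h2 => ?_
  by_contra! hlt
  have hκ : 0 < 1 - α - β := by linarith
  have hC := bigC_pos hαβ
  have hC4 := bigC_le_four hα hβ hαβ
  have haD := ha_pos D
  have hbD := hb_pos D
  set q : ℝ := bigC α β * σ / (4 * b D) with hq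
  have hq0 : 0 < q := by positivity
  have hq1 : q ≤ 1 := by rw [hq, div_le_one (by positivity)]; linarith
  set θ₀ : L2 := finSignal {D} (fun _ => (a D)⁻¹) with hθ₀
  -- The benchmark is the largest multiple of the `D`-th unit vector in the ellipsoid; the
  -- alternative is `(1 + q) θ₀`, at distance `q / a_D`, the square root of the bound to be proved.
  -- Only the difference `τ` has to lie in the ellipsoid, for which `q ≤ 1` suffices.
  have hθ₀b : θ₀ ∈ benchmarks a := finSignal_singleton_mem_benchmarks haD
  set τ : L2 := finSignal {D} (fun _ => q * (a D)⁻¹) with hτ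
  have halt : (θ₀ + τ) - θ₀ ∈ alternatives a r := by
    rw [add_sub_cancel_left]
    refine finSignal_mem_alternatives ?_ ?_
    · rw [Finset.sum_singleton, mul_pow, inv_pow, mul_left_comm,
        mul_inv_cancel₀ (by positivity), mul_one]
      exact pow_le_one₀ hq0.le hq1
    · rw [Finset.sum_singleton]
      refine hlt.le.trans (le_of_eq ?_)
      rw [hq]
      field_simp
      norm_num
  -- The `D`-th values satisfy `b₀ = (1 + q) b₁`, which compensates exactly for the factor `1 + q`
  -- in the signal. The upper end stays below `C₁ b_D` by `hD2` and `C₀ ≤ 1`.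
  set b₀ : ℕ+ → ℝ := Function.update b D (C₀ * b D + C₀ * (bigC α β * σ / 4)) with hb₀
  set b₁ : ℕ+ → ℝ := Function.update b D (C₀ * b D) with hb₁
  have hnear : ∀ x, C₀ * b D ≤ x → x ≤ C₁ * b D → Function.update b D x ∈ nearby C₀ C₁ b := by
    intro x hx1 hx2 j
    by_cases hj : j = D
    · subst hj
      have : 0 < C₀ * b j := by positivity
      rw [Function.update_self, abs_of_pos hbD, abs_of_pos (by linarith)]
      exact ⟨hx1, hx2⟩
    · rw [Function.update_of_ne hj]
      exact mem_nearby_self hC₀_le hC₁_ge b j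
  have hb₀n : b₀ ∈ nearby C₀ C₁ b := by
    refine hnear _ ?_ ?_
    · have : 0 ≤ C₀ * (bigC α β * σ / 4) := by positivity
      linarith
    · have : C₀ * (bigC α β * σ / 4) ≤ bigC α β * σ / 4 :=
        mul_le_of_le_one_left (by positivity) hC₀_le
      linarith
  have hb₁n : b₁ ∈ nearby C₀ C₁ b := hnear _ le_rfl (by gcongr; linarith)
  -- A single alternative: the shift `b₁ - b₀` of `X` in units of `σ`.
  set h : Unit → ℕ+ → ℝ := fun _ j => if j = D then -(C₀ * (bigC α β / 4)) else 0 with hh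
  have hsupp : ∀ i, ∀ j ∉ ({D} : Finset ℕ+), h i j = 0 := by
    intro i j hj
    simp [hh, Finset.mem_singleton.not.1 hj]
  have hdiv : ∑ i, ∑ k, Real.exp (∑ j ∈ ({D} : Finset ℕ+), h i j * h k j) <
      (Fintype.card Unit : ℝ) ^ 2 * (1 + 4 * (1 - α - β) ^ 2) := by
    simp only [Finset.univ_unique, Finset.sum_singleton, hh, if_true, Fintype.card_unit,
      Nat.cast_one, one_pow, one_mul]
    rw [← Real.lt_log_iff_exp_lt (by positivity)]
    have hx0 : 0 ≤ C₀ * (bigC α β / 4) := by positivity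
    have hx : C₀ * (bigC α β / 4) ≤ bigC α β / 4 :=
      mul_le_of_le_one_left (by positivity) hC₀_le
    change _ < bigC α β
    -- The squared shift is at most `(C_{α,β} / 4)² ≤ C_{α,β} / 4 < C_{α,β}`, by `C_{α,β} ≤ 4`.
    nlinarith
  obtain ⟨i, hi⟩ := exists_lt_integral_add_integral {D} h hsupp
    (fun x => Ψ θ₀ ((fun j => b₀ j * θ₀ j), (fun j => b₀ j + σ * x j)))
    ((hΨ.measurable θ₀).comp (by fun_prop)) (fun x => hΨ.mem _ _) _ hκ hdiv
  have e1 := integral_le_of_firstKind_le hΨ hα h1 hθ₀b hb₀n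
  have e2 := integral_le_of_secondKind_le hΨ hβ h2 hθ₀b halt hb₁n
  rw [integral_law_zero_left _ _ _ (hΨ.measurable θ₀)] at e1
  rw [integral_law_zero_left _ _ _ ((hΨ.measurable θ₀).const_sub 1)] at e2
  have hY : (fun j => b₁ j * (θ₀ + τ : L2) j) = fun j => b₀ j * θ₀ j := by
    ext j
    simp only [lp.coeFn_add, Pi.add_apply, hθ₀, hτ, finSignal_apply, Finset.mem_singleton]
    by_cases hj : j = D
    · subst hj
      simp only [if_true, hb₀, hb₁, Function.update_self, hq]
      field_simp
    · simp [hj]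
  have hX : ∀ x : ℕ+ → ℝ, (fun j => b₁ j + σ * x j) = fun j => b₀ j + σ * (x + h i) j := by
    intro x
    ext j
    by_cases hj : j = D
    · subst hj
      simp only [hb₀, hb₁, Function.update_self, Pi.add_apply, hh, if_true]
      ring
    · simp [hb₀, hb₁, hh, hj]
  simp only [hY, hX] at e2
  linarith

theorem exists_mem_admissible_of_le_bandwidth {C₀ C₁ α β σ : ℝ} {b : ℕ+ → ℝ} {D : ℕ+}
    (h : ((D : ℕ) : ℕ∞) ≤ bandwidth C₀ C₁ α β σ b) : ∃ D' ∈ admissible C₀ C₁ α β σ b, D ≤ D' := by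
  by_contra! hcon
  -- Without admissible indices from `D` on, the supremum is at most `D - 1`, and `D ≥ 1` makes this
  -- smaller than `D`. An empty or unbounded admissible set needs no separate case.
  have hle : bandwidth C₀ C₁ α β σ b ≤ (((D : ℕ) - 1 : ℕ) : ℕ∞) := by
    refine iSup₂_le fun D' hD' => ?_
    have : (D' : ℕ) < D := hcon D' hD'
    exact_mod_cast (by omega : (D' : ℕ) ≤ D - 1)
  have h' : (D : ℕ) ≤ (D : ℕ) - 1 := by exact_mod_cast h.trans hle
  have := D.pos
  omega

end GSM

end

theorem theorem4
    (a b : ℕ+ → ℝ) (ha_pos : ∀ j, 0 < a j) (ha_mono : Monotone a)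
    (ha_lim : Filter.Tendsto a Filter.atTop Filter.atTop) (hb_pos : ∀ j, 0 < b j)
    (C₀ C₁ : ℝ) (hC₀ : 0 < C₀) (hC₀_le : C₀ ≤ 1) (hC₁_ge : 1 ≤ C₁)
    (α β : ℝ) (hα : α ∈ Set.Ioo (0 : ℝ) 1) (hβ : β ∈ Set.Ioo (0 : ℝ) 1)
    (V : Set ℝ) (hV : V = {0, 1} ∨ V = Set.Icc 0 1)
    (ε σ : ℝ) (hε : 0 < ε) (hσ : 0 < σ) :
    -- the comparison with both extreme models, for any set `T` of benchmarks
    -- (one given benchmark, or all of them)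
    (∀ T : Set GSM.L2, T ⊆ GSM.benchmarks a →
      GSM.minimaxRadius (Set.Icc 0 1) T (GSM.nearby C₀ C₁ b) a α β 0 σ ⊔
          GSM.minimaxRadius (Set.Icc 0 1) T {b} a α β ε 0
        ≤ GSM.minimaxRadius V T (GSM.nearby C₀ C₁ b) a α β ε σ) ∧
    -- the explicit lower bound
    (α + β < 1 →
      (⨆ D ∈ GSM.admissible C₀ C₁ α β σ b, GSM.sigmaTerm a b α β σ D) ⊔
          (⨆ D : ℕ+, GSM.epsTerm a b α β ε D)
        ≤ GSM.minimaxRadius V (GSM.benchmarks a) (GSM.nearby C₀ C₁ b) a α β ε σ ^ 2) ∧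
    -- the same with `1 ≤ D ≤ M₂`, for a non-increasing sequence `b`
    (α + β < 1 → Antitone b →
      (⨆ D : ℕ+, ⨆ _ : ((D : ℕ) : ℕ∞) ≤ GSM.bandwidth C₀ C₁ α β σ b,
          GSM.sigmaTerm a b α β σ D) ⊔
          (⨆ D : ℕ+, GSM.epsTerm a b α β ε D)
        ≤ GSM.minimaxRadius V (GSM.benchmarks a) (GSM.nearby C₀ C₁ b) a α β ε σ ^ 2) := by
  have hV' := GSM.subset_Icc_of_eq hV
  have hb_near := GSM.mem_nearby_self hC₀_le hC₁_ge b
  have heps : α + β < 1 → (⨆ D : ℕ+, GSM.epsTerm a b α β ε D) ≤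
      GSM.minimaxRadius V (GSM.benchmarks a) (GSM.nearby C₀ C₁ b) a α β ε σ ^ 2 := by
    intro hαβ
    refine iSup_le fun D => (GSM.epsTerm_le_minimaxRadius_sq a b ha_pos ha_mono hb_pos α β hα.1.le
      hβ.1.le hαβ ε hε D).trans ?_
    gcongr
    exact GSM.minimaxRadius_zero_right_le hV' _ (Set.singleton_subset_iff.2 hb_near) a α β ε σ
  -- Stated for two indices to serve both forms of the bound: `D' = D` for the admissible set, and
  -- `D' ≤ D` with `b` non-increasing for the bandwidth.
  have hsig : α + β < 1 → ∀ D D' : ℕ+, D ∈ GSM.admissible C₀ C₁ α β σ b → b D ≤ b D' →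
      GSM.sigmaTerm a b α β σ D' ≤
      GSM.minimaxRadius V (GSM.benchmarks a) (GSM.nearby C₀ C₁ b) a α β ε σ ^ 2 := by
    intro hαβ D D' hD hDD'
    obtain ⟨h1, h2⟩ := GSM.le_of_mem_admissible (hb_pos D) hC₀_le hC₁_ge hσ hα.1.le hβ.1.le hαβ hD
    have h3 : (C₁ - C₀) * b D ≤ (C₁ - C₀) * b D' :=
      mul_le_mul_of_nonneg_left hDD' (by linarith)
    refine (GSM.sigmaTerm_le_minimaxRadius_sq a b ha_pos hb_pos hC₀ hC₀_le hC₁_ge α β hα.1.le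
      hβ.1.le hαβ σ hσ D' (by linarith) (h2.trans h3)).trans ?_
    gcongr
    exact GSM.minimaxRadius_zero_left_le hV' _ _ a α β ε σ
  refine ⟨fun T _ => sup_le (GSM.minimaxRadius_zero_left_le hV' T _ a α β ε σ)
    (GSM.minimaxRadius_zero_right_le hV' T (Set.singleton_subset_iff.2 hb_near) a α β ε σ),
    fun hαβ => sup_le (iSup₂_le fun D hD => hsig hαβ D D hD le_rfl) (heps hαβ),
    fun hαβ hb => sup_le (iSup₂_le fun D hD => ?_) (heps hαβ)⟩
  obtain ⟨D', hD', hDD'⟩ := GSM.exists_mem_admissible_of_le_bandwidth hD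
  exact hsig hαβ D' D hD' (hb hDD')
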